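/- **Theorem (Embedding random walks via patterns).** Let $\mathcal{T}$ be the set of terms over a finite signature and an infinite set of variables. Substitutions have finite domain $\mathrm{dom}(\sigma)=\{x\mid x\sigma\neq x\}$, are applied in postfix notation and are composed from left to right; $\mathcal{V}(t)$ is the set of variables of $t$ and $t|_\pi$ is the subterm of $t$ at position $\pi$. *Probabilistic rewriting.* A finite multi-distribution is a finite multiset of pairs $(p:a)$ with $0<p\le 1$ whose probabilities add up to $1$. A probabilistic term rewrite system (PTRS) $\mathcal{P}$ is a finite set of rules $\ell\to\{p_1:r_1,\dots,p_k:r_k\}$, where $\ell$ is a term that is not a variable, the right-hand side is a finite multi-distribution on terms, and $\mathcal{V}(r_j)\subseteq\mathcal{V}(\ell)$ for all $j$. Then $s\to_{\mathcal{P}}\{p_1:t_1,\dots,p_k:t_k\}$ holds if there are a position $\pi$ of $s$, such a rule and a substitution $\delta$ with $s|_\pi=\ell\delta$ and $t_j=s[r_j\delta]_\pi$ for all $j$. A $\mathcal{P}$-rewrite sequence tree (RST) is a possibly infinite tree whose nodes $v$ are labeled by a probability $p_v\in(0,1]$ and a term $t_v$, with probability $1$ at the root, such that every node $v$ has finitely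 many successors $w_1,\dots,w_k$ and, if $k>0$, $t_v\to_{\mathcal{P}}\{\frac{p_{w_1}}{p_v}:t_{w_1},\dots,\frac{p_{w_k}}{p_v}:t_{w_k}\}$. A leaf is a node without successors (its term need not be a normal form), $d(v)$ is the depth of $v$, and the height $h(\mathfrak{T})$ of an RST $\mathfrak{T}$ is the supremum of the depths of its nodes. Let $|\mathfrak{T}|=\sum_{v\in\mathrm{Leaf}(\mathfrak{T})}p_v$, and let $\mathrm{edl}(\mathfrak{T})=\infty$ if $|\mathfrak{T}|<1$ and $\mathrm{edl}(\mathfrak{T})=\sum_{v\in\mathrm{Leaf}(\mathfrak{T})}d(v)\cdot p_v$ otherwise. $\mathcal{P}$ is AST if $|\mathfrak{T}|=1$ for all $\mathcal{P}$-RSTs $\mathfrak{T}$, and PAST if $\mathrm{edl}(\mathfrak{T})<\infty$ for all $\mathcal{P}$-RSTs $\mathfrak{T}$. *Patterns.* A pair $\langle t,\sigma\rangle$ of a term and a substitution is a pattern term if the terms $t,t\sigma,t\sigma^2,\dots$ are pairwise different. A term $u$ occurs in $s$ at a position $\pi$ of $s$ if $s|_\pi=u\delta$ for some substitution $\delta$.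 If $t$ occurs in $s$ at $\pi$, then the multiplicity $m_\pi$ of $\langle t,\sigma\rangle$ at $\pi$ is the maximal $m\in\mathbb{N}$ such that $t\sigma^m$ occurs in $s$ at $\pi$. Positions $\pi_1,\pi_2$ overlap w.r.t. $t$ if $\pi_1=\pi_2.\tau$ or $\pi_2=\pi_1.\tau$ for some position $\tau$ of a function symbol in $t$, and they are orthogonal if neither is a prefix of the other. $\mathrm{maxOPO}(t,\sigma,s)$ is the maximum of $\sum_{\pi\in S}m_\pi$ over all sets $S$ of positions of $s$ at which $t$ occurs and which are pairwise non-overlapping w.r.t. $t$ and pairwise orthogonal. A $\mathcal{P}$-RST $\mathfrak{T}$ is a $\mathcal{P}$-pattern tree for $\langle t,\sigma\rangle$ if its root is labeled by the term $t\sigma$, if $t$ occurs in $t_v$ for every leaf $v$, and if for every leaf $v$, every $q\ge 0$, every position $\pi$ of $t_v$ and every substitution $\kappa$ with $t\sigma^q\kappa=t_v|_\pi$ and $\mathrm{dom}(\kappa)\subseteq\mathcal{V}(t\sigma^q)$ we have $\sigma\kappa=\kappa\sigma$. *Claim.* Let $\mathcal{P}$ be a PTRS, let $\langle t,\sigma\rangle$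 be a pattern term, and let $\mathfrak{T}$ be a (finite or infinite) $\mathcal{P}$-pattern tree for $\langle t,\sigma\rangle$ with $h(\mathfrak{T})>0$. 1. If $\sum_{v\in\mathrm{Leaf}(\mathfrak{T})}p_v\cdot\mathrm{maxOPO}(t,\sigma,t_v)>1$, then $\mathcal{P}$ is not AST. 2. If $\sum_{v\in\mathrm{Leaf}(\mathfrak{T})}p_v\cdot\mathrm{maxOPO}(t,\sigma,t_v)\ge 1$, then $\mathcal{P}$ is not PAST. (For infinite $\mathfrak{T}$ the sum is taken in $[0,\infty]$.) -/

import Mathlib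

open scoped ENNReal

universe u v w

namespace ProbRewriting

/-! ## Probabilistic abstract reduction systems and rewrite sequence trees -/

/-- A finite multi-distribution on `A`: a finite multiset of pairs `(p : a)` with `0 < p ≤ 1`
whose probabilities sum up to `1`. -/
structure FDist (A : Type w) where
  pairs : Multiset (ℝ × A)
  prob_mem : ∀ pa ∈ pairs, 0 < pa.1 ∧ pa.1 ≤ 1
  sum_eq_one : (pairs.map Prod.fst).sum = 1

/-- A probabilistic abstract reduction system (PARS) on `A`. -/
abbrev PARS (A : Type w) : Type w := A → FDist A → Prop

/-- The nodes of a finitely branching ordered tree, where `br v` is the number of direct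
successors of the node `v`.  A node is the list of choices leading to it from the root, the last
choice first: `[]` is the root, and the direct successors of `v` are `i :: v` for `i < br v`. -/
def IsNode (br : List ℕ → ℕ) : List ℕ → Prop
  | [] => True
  | i :: v => IsNode br v ∧ i < br v

/-- A (possibly infinite) rewrite sequence tree (RST) of a PARS `r`. Every node `v` is labeled by
a probability `prob v` and an object `obj v`; the values of the labels and of `br` outside the set
of nodes are irrelevant. Leaves need not be normal forms. -/
structure RST {A : Type w} (r : PARS A) where
  br : List ℕ → ℕ
  prob : List ℕ → ℝ
  obj : List ℕ → A
  prob_root : prob [] = 1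
  prob_mem : ∀ v, IsNode br v → 0 < prob v ∧ prob v ≤ 1
  step : ∀ v, IsNode br v → 0 < br v → ∃ μ : FDist A, r (obj v) μ ∧
    μ.pairs = (Multiset.range (br v)).map fun i => (prob (i :: v) / prob v, obj (i :: v))

namespace RST

variable {A : Type w} {r : PARS A}

/-- The set of nodes `V(T)`. -/
def nodes (T : RST r) : Set (List ℕ) := {v | IsNode T.br v}

/-- The set of leaves `Leaf(T)`: nodes without direct successors. -/
def leaves (T : RST r) : Set (List ℕ) := {v | v ∈ T.nodes ∧ T.br v = 0}

/-- The object at the root. -/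
def root (T : RST r) : A := T.obj []

/-- The depth of a node: the number of steps from the root to it. -/
def depth (_T : RST r) (v : List ℕ) : ℕ := v.length

/-- The height of the tree: the supremum of the depths of its nodes. -/
noncomputable def height (T : RST r) : ℕ∞ := ⨆ v ∈ T.nodes, (T.depth v : ℕ∞)

/-- The termination probability `|T|`. -/
noncomputable def termProb (T : RST r) : ℝ≥0∞ :=
  ∑' v : T.leaves, ENNReal.ofReal (T.prob v)

open Classical in
/-- The expected derivation length: `∞` if `|T| < 1`, and the expected depth of the leaves
otherwise. -/
noncomputable def edl (T : RST r) : ℝ≥0∞ :=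
  if T.termProb < 1 then ∞
  else ∑' v : T.leaves, (T.depth v : ℝ≥0∞) * ENNReal.ofReal (T.prob v)

end RST

/-- Almost-sure termination of a PARS. -/
def IsAST {A : Type w} (r : PARS A) : Prop := ∀ T : RST r, T.termProb = 1

/-- Positive almost-sure termination of a PARS. -/
def IsPAST {A : Type w} (r : PARS A) : Prop := ∀ T : RST r, T.edl < ∞

/-! ## Terms, substitutions, and positions

Terms over the function symbols of `L` and the variables `X` are `L.Term X`; the relation symbols
of `L` play no role. -/

section Terms

variable {L : FirstOrder.Language.{u, v}} {X : Type w}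

open Classical in
/-- The set `V(t)` of variables occurring in `t`. -/
noncomputable def vars (t : L.Term X) : Set X := ↑t.varFinset

/-- The domain of a map from variables to terms. -/
def dom (σ : X → L.Term X) : Set X := {x | σ x ≠ FirstOrder.Language.Term.var x}

variable (L X) in
/-- A substitution: a map from variables to terms with finite domain. -/
structure Subst where
  toFun : X → L.Term X
  finite_dom : (dom toFun).Finite

/-- The instance `tσ`. -/
def inst (t : L.Term X) (σ : Subst L X) : L.Term X := t.subst σ.toFun

/-- The iterated instance `tσ^m`. -/
def instPow (t : L.Term X) (σ : Subst L X) (m : ℕ) : L.Term X :=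
  (fun s => inst s σ)^[m] t

/-- `σκ = κσ`, where substitutions are composed from left to right. -/
def Subst.Commutes (σ κ : Subst L X) : Prop :=
  ∀ x : X, inst (σ.toFun x) κ = inst (κ.toFun x) σ

/-- The subterm `t|_π`, or `none` if `π` is not a position of `t`. Positions are lists of argument
indices, where the arguments are numbered starting from `0`. -/
def subtermAt : L.Term X → List ℕ → Option (L.Term X)
  | t, [] => some t
  | .var _, _ :: _ => none
  | .func (l := n) _ ts, i :: π => if h : i < n then subtermAt (ts ⟨i, h⟩) π else none

/-- The term `t[s]_π`; it is only used for positions `π` of `t`. -/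
def replaceAt : L.Term X → List ℕ → L.Term X → L.Term X
  | _, [], s => s
  | .var x, _ :: _, _ => .var x
  | .func (l := n) f ts, i :: π, s =>
      if h : i < n then .func f (Function.update ts ⟨i, h⟩ (replaceAt (ts ⟨i, h⟩) π s))
      else .func f ts

/-- The set `Pos(t)` of positions of `t`. -/
def positions (t : L.Term X) : Set (List ℕ) := {π | ∃ s, subtermAt t π = some s}

/-- The set `Pos_Σ(t)` of positions of function symbols in `t`. -/
def funPositions (t : L.Term X) : Set (List ℕ) :=
  {π | ∃ (n : ℕ) (f : L.Functions n) (ts : Fin n → L.Term X), subtermAt t π = some (.func f ts)}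

/-- Orthogonality of positions: neither is a prefix of the other. -/
def Orthogonal (π₁ π₂ : List ℕ) : Prop := ¬ π₁ <+: π₂ ∧ ¬ π₂ <+: π₁

/-! ## Probabilistic term rewriting -/

variable (L X) in
/-- A probabilistic term rewrite rule. -/
structure ProbRule where
  lhs : L.Term X
  rhs : FDist (L.Term X)
  lhs_not_var : ∀ x : X, lhs ≠ .var x
  vars_subset : ∀ pr ∈ rhs.pairs, vars pr.2 ⊆ vars lhs

variable (L X) in
/-- A probabilistic term rewrite system: a finite set of probabilistic rewrite rules. -/
structure PTRS where
  rules : Set (ProbRule L X)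
  finite_rules : rules.Finite

/-- The PARS on terms induced by a PTRS. -/
def PTRS.step (P : PTRS L X) : PARS (L.Term X) := fun s μ =>
  ∃ (π : List ℕ) (ρ : ProbRule L X) (σ : Subst L X), ρ ∈ P.rules ∧
    subtermAt s π = some (inst ρ.lhs σ) ∧
    μ.pairs = ρ.rhs.pairs.map fun pr => (pr.1, replaceAt s π (inst pr.2 σ))

/-! ## Occurrences, pattern terms, and pattern trees -/

/-- `t` occurs in `s` at position `π`. -/
def OccursAt (t s : L.Term X) (π : List ℕ) : Prop :=
  ∃ σ : Subst L X, subtermAt s π = some (inst t σ)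

/-- The positions `π₁` and `π₂` are overlapping w.r.t. `t`. -/
def Overlapping (t : L.Term X) (π₁ π₂ : List ℕ) : Prop :=
  ∃ τ ∈ funPositions t, π₁ = π₂ ++ τ ∨ π₂ = π₁ ++ τ

/-- `NO(t, s)`: the sets of pairwise non-overlapping occurrences of `t` in `s`. -/
def NO (t s : L.Term X) : Set (Finset (List ℕ)) :=
  {S | (∀ π ∈ S, π ∈ positions s) ∧ (∀ π ∈ S, OccursAt t s π) ∧
    ∀ π₁ ∈ S, ∀ π₂ ∈ S, π₁ ≠ π₂ → ¬ Overlapping t π₁ π₂}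

/-- `⟨t, σ⟩` is a pattern term. -/
def IsPatternTerm (t : L.Term X) (σ : Subst L X) : Prop :=
  ∀ m m' : ℕ, m ≠ m' → instPow t σ m ≠ instPow t σ m'

/-- The multiplicity `m_π` of the occurrence of `⟨t, σ⟩` in `s` at position `π`: the maximal `m`
such that `tσ^m` occurs in `s` at `π`. -/
noncomputable def multiplicity (t : L.Term X) (σ : Subst L X) (s : L.Term X) (π : List ℕ) : ℕ∞ :=
  ⨆ m ∈ {m : ℕ | OccursAt (instPow t σ m) s π}, (m : ℕ∞)

/-- `maxOPO(t, σ, s)`: the maximal sum of multiplicities over a set of pairwise orthogonal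
occurrences of `⟨t, σ⟩` in `s`. -/
noncomputable def maxOPO (t : L.Term X) (σ : Subst L X) (s : L.Term X) : ℕ∞ :=
  ⨆ S ∈ {S | S ∈ NO t s ∧ ∀ π₁ ∈ S, ∀ π₂ ∈ S, π₁ ≠ π₂ → Orthogonal π₁ π₂},
    ∑ π ∈ S, multiplicity t σ s π

/-- `κ` is the matching substitution with `tκ = s`. Such a `κ` is only determined by `t` and `s`
on the variables of `t`; as usual it is the identity on all other variables. -/
def IsMatcher (t s : L.Term X) (κ : Subst L X) : Prop :=
  inst t κ = s ∧ dom κ.toFun ⊆ vars t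

/-- `T` is a `P`-pattern tree for `⟨t, σ⟩`. -/
structure IsPatternTree {P : PTRS L X} (T : RST P.step) (t : L.Term X) (σ : Subst L X) :
    Prop where
  root_eq : T.root = inst t σ
  occurs : ∀ v ∈ T.leaves, ∃ π, OccursAt t (T.obj v) π
  commutes : ∀ v ∈ T.leaves, ∀ (q : ℕ) (π : List ℕ) (s : L.Term X) (κ : Subst L X),
    subtermAt (T.obj v) π = some s → IsMatcher (instPow t σ q) s κ → σ.Commutes κ

end Terms

end ProbRewriting

/-!
The pattern tree embeds a random walk on `ℕ` into rewriting. Call the sum of the exponents `m`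
over a set of pairwise orthogonal occurrences of terms `tσ^m` in `s` a weight of `s`
(`HasWeight`). In a term of weight `x + 1`, some occurrence has the form `tσ^(k+1)κ'`, which is
the instance by `δ = σ^k κ'` of the label `tσ` of the root of the pattern tree `T`. Hence all of
`T` can be replayed there (`PTRS.step_replaceAt_inst`). Since the matchers in the leaves of `T`
commute with `σ`, an occurrence of `tσ^q` in the leaf `v` becomes an occurrence of `tσ^(q+k)`, so
that the new term has weight `x + W v` if `W v ≤ maxOPO t σ (T.obj v)` (`HasWeight.exists_redex`).
Repeating this until the weight is `0` gives one rewrite sequence tree that simulates the walk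
`x + 1 ↦ x + W v`, started in `1` (`exists_walk_tree`).

The walk is analysed by a Lyapunov function instead of limit theorems. For `0 < c < 1`, the
function `1 - c^x` is bounded by `1`, vanishes at `0`, and a round of the walk decreases its
expectation by at most `d = max 0 ((1 - c) - E[1 - c^W])`. Inside a round it is interpolated by
conditional expectations (`potential`), where paths of `T` that reach no leaf above a level `N`
are dropped; in particular, `T` need not terminate almost surely. For a tree that terminates
almost surely, the value of such a function at the root is at most `d` times the expected
derivation length (`RST.le_mul_edl`), and it is at most `0` if `d = 0`
(`RST.nonpos_of_termProb_eq_one`). Every round contains at least one rewrite step, because `T` has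
positive height.

For every `θ < E[W]` and some `c` close to `1`, already a truncation of the expectation
`E[1 - c^W]` is at least `(1 - c) * θ` (`RST.exists_base`). If `E[W] > 1`, then `d = 0` for some `c`
while the value at the root is positive, so the tree does not terminate almost surely. If
`E[W] ≥ 1`, then for every `ε > 0` there is a `c` such that `d` can be chosen as `(1 - c) * ε` while the
value at the root is at least `(1 - c) * (1 - ε)`. Hence the expected derivation length is at
least `(1 - ε) / ε` for every `ε > 0`.
-/

namespace ProbRewriting

/-! ### Terms, substitutions and positions -/

section Terms

variable {L : FirstOrder.Language.{u, v}} {X : Type w}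

/-- Composition of substitutions from left to right. -/
def Subst.comp (σ κ : Subst L X) : Subst L X where
  toFun x := inst (σ.toFun x) κ
  finite_dom := by
    refine (σ.finite_dom.union κ.finite_dom).subset fun x hx => ?_
    by_contra h
    simp only [dom, Set.mem_union, Set.mem_ofPred_eq, not_or, not_not] at h
    exact hx (by simp [h.1, inst, h.2])

/-- The identity substitution. -/
def Subst.id : Subst L X where
  toFun := .var
  finite_dom := by simp [dom]

theorem inst_id (s : L.Term X) : inst s Subst.id = s := by
  induction s with
  | var x => rfl
  | func f ts ih =>
    simp only [inst, FirstOrder.Language.Term.subst] at ih ⊢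
    congr 1
    exact funext ih

theorem inst_comp (s : L.Term X) (σ κ : Subst L X) :
    inst s (σ.comp κ) = inst (inst s σ) κ := by
  induction s with
  | var x => rfl
  | func f ts ih =>
    simp only [inst, FirstOrder.Language.Term.subst] at ih ⊢
    congr 1
    exact funext ih

theorem inst_congr {s : L.Term X} {σ κ : Subst L X}
    (h : ∀ x ∈ vars s, σ.toFun x = κ.toFun x) : inst s σ = inst s κ := by
  classical
  induction s with
  | var x => exact h x (by simp [vars])
  | func f ts ih =>
    simp only [inst, FirstOrder.Language.Term.subst] at ih ⊢
    congr 1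
    refine funext fun i => ih i fun x hx => h x ?_
    simp only [vars, FirstOrder.Language.Term.varFinset, Finset.coe_biUnion, Set.mem_iUnion] at hx ⊢
    exact ⟨i, by simp, hx⟩

/-- Every instance of `s` has a matcher, the restriction of the instantiating substitution to the
variables of `s`. -/
theorem exists_isMatcher (s : L.Term X) (δ : Subst L X) :
    ∃ κ : Subst L X, IsMatcher s (inst s δ) κ := by
  classical
  refine ⟨⟨fun x => if x ∈ vars s then δ.toFun x else .var x, ?_⟩, ?_, ?_⟩
  · refine δ.finite_dom.subset fun x hx => ?_
    by_cases h : x ∈ vars s <;> simp_all [dom]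
  · exact inst_congr fun x hx => if_pos hx
  · intro x hx
    by_contra h
    exact hx (if_neg h)

theorem instPow_add (s : L.Term X) (σ : Subst L X) (m n : ℕ) :
    instPow s σ (m + n) = instPow (instPow s σ m) σ n := by
  rw [Nat.add_comm]
  exact Function.iterate_add_apply _ n m s

theorem Subst.Commutes.inst_inst {σ κ : Subst L X} (h : σ.Commutes κ) (s : L.Term X) :
    inst (inst s κ) σ = inst (inst s σ) κ := by
  rw [← inst_comp, ← inst_comp]
  exact inst_congr fun x _ => (h x).symm

theorem Subst.Commutes.instPow_inst {σ κ : Subst L X} (h : σ.Commutes κ) (s : L.Term X) (m : ℕ) :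
    instPow (inst s κ) σ m = inst (instPow s σ m) κ := by
  induction m generalizing s with
  | zero => rfl
  | succ m ih =>
    rw [Nat.add_comm, instPow_add, instPow_add]
    change instPow (inst (inst s κ) σ) σ m = inst (instPow (inst s σ) σ m) κ
    rw [h.inst_inst, ih]

/-- The substitution `σ^m κ` exists. -/
theorem exists_inst_eq_instPow (σ κ : Subst L X) (m : ℕ) :
    ∃ δ : Subst L X, ∀ s, inst s δ = inst (instPow s σ m) κ := by
  induction m with
  | zero => exact ⟨κ, fun _ => rfl⟩
  | succ m ih =>
    obtain ⟨δ, hδ⟩ := ih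
    refine ⟨σ.comp δ, fun s => ?_⟩
    rw [inst_comp, hδ, Nat.add_comm, instPow_add]
    rfl

theorem subtermAt_append (s : L.Term X) (π τ : List ℕ) :
    subtermAt s (π ++ τ) = (subtermAt s π).bind fun a => subtermAt a τ := by
  induction π generalizing s with
  | nil => simp [subtermAt]
  | cons i π ih =>
    cases s with
    | var x => simp [subtermAt]
    | func f ts =>
      simp only [List.cons_append, subtermAt]
      split_ifs <;> simp [ih]

theorem subtermAt_inst {s a : L.Term X} {π : List ℕ} (δ : Subst L X)
    (h : subtermAt s π = some a) : subtermAt (inst s δ) π = some (inst a δ) := by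
  induction π generalizing s with
  | nil =>
    simp only [subtermAt, Option.some.injEq] at h ⊢
    rw [h]
  | cons i π ih =>
    cases s with
    | var x => simp [subtermAt] at h
    | func f ts =>
      simp only [subtermAt] at h
      split_ifs at h with hi
      simpa [inst, subtermAt, FirstOrder.Language.Term.subst, hi] using ih h

theorem replaceAt_self {s a : L.Term X} {π : List ℕ} (h : subtermAt s π = some a) :
    replaceAt s π a = s := by
  induction π generalizing s with
  | nil =>
    simp only [subtermAt, Option.some.injEq] at h
    simp [replaceAt, h]
  | cons i π ih =>
    cases s with
    | var x => simp [subtermAt] at h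
    | func f ts =>
      simp only [subtermAt] at h
      split_ifs at h with hi
      simp [replaceAt, hi, ih h]

theorem subtermAt_replaceAt {s a : L.Term X} {π : List ℕ} (h : subtermAt s π = some a)
    (b : L.Term X) : subtermAt (replaceAt s π b) π = some b := by
  induction π generalizing s with
  | nil => simp [replaceAt, subtermAt]
  | cons i π ih =>
    cases s with
    | var x => simp [subtermAt] at h
    | func f ts =>
      simp only [subtermAt] at h
      split_ifs at h with hi
      simp [replaceAt, hi, subtermAt, ih h]

theorem subtermAt_replaceAt_append {s a : L.Term X} {π : List ℕ} (h : subtermAt s π = some a)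
    (b : L.Term X) (τ : List ℕ) :
    subtermAt (replaceAt s π b) (π ++ τ) = subtermAt b τ := by
  rw [subtermAt_append, subtermAt_replaceAt h]
  rfl

theorem subtermAt_replaceAt_of_orthogonal (s b : L.Term X) {π τ : List ℕ}
    (h : Orthogonal π τ) : subtermAt (replaceAt s π b) τ = subtermAt s τ := by
  induction π generalizing s τ with
  | nil => exact absurd List.nil_prefix h.1
  | cons i π ih =>
    cases τ with
    | nil => exact absurd List.nil_prefix h.2
    | cons j τ =>
      cases s with
      | var x => rfl
      | func f ts =>
        simp only [replaceAt]
        split_ifs with hi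
        · simp only [subtermAt]
          split_ifs with hj
          · by_cases hij : i = j
            · subst hij
              rw [Function.update_self]
              exact ih _ (by simpa [Orthogonal, List.cons_prefix_cons] using h)
            · rw [Function.update_of_ne]
              simpa using Ne.symm hij
          · rfl
        · rfl

theorem replaceAt_inst {s a : L.Term X} {π : List ℕ} (h : subtermAt s π = some a)
    (b : L.Term X) (δ : Subst L X) :
    inst (replaceAt s π b) δ = replaceAt (inst s δ) π (inst b δ) := by
  induction π generalizing s with
  | nil => simp [replaceAt]
  | cons i π ih =>
    cases s with
    | var x => simp [subtermAt] at h
    | func f ts =>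
      simp only [subtermAt] at h
      split_ifs at h with hi
      have ih := ih h
      simp only [inst] at ih ⊢
      simp only [replaceAt, FirstOrder.Language.Term.subst, hi, dite_true]
      congr 1
      funext j
      by_cases hj : j = ⟨i, hi⟩
      · subst hj
        simp [ih]
      · simp [Function.update_of_ne hj]

theorem replaceAt_replaceAt_append {s a : L.Term X} {π : List ℕ} (h : subtermAt s π = some a)
    (b c : L.Term X) (τ : List ℕ) :
    replaceAt (replaceAt s π b) (π ++ τ) c = replaceAt s π (replaceAt b τ c) := by
  induction π generalizing s with
  | nil => simp [replaceAt]
  | cons i π ih =>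
    cases s with
    | var x => simp [subtermAt] at h
    | func f ts =>
      simp only [subtermAt] at h
      split_ifs at h with hi
      simp [replaceAt, hi, ih h]

/-! ### Probabilistic rewriting is closed under substitutions and contexts -/

/-- The image of a multi-distribution under a map. -/
def FDist.map {A : Type*} {B : Type*} (g : A → B) (μ : FDist A) : FDist B where
  pairs := μ.pairs.map fun pa => (pa.1, g pa.2)
  prob_mem := by
    intro pb h
    obtain ⟨pa, hpa, rfl⟩ := Multiset.mem_map.1 h
    exact μ.prob_mem pa hpa
  sum_eq_one := by simpa [Multiset.map_map, Function.comp_def] using μ.sum_eq_one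

theorem PTRS.step_replaceAt_inst {P : PTRS L X} {s : L.Term X} {μ : FDist (L.Term X)}
    (h : P.step s μ) {b a : L.Term X} {π : List ℕ} (hb : subtermAt b π = some a)
    (δ : Subst L X) :
    P.step (replaceAt b π (inst s δ)) (μ.map fun r => replaceAt b π (inst r δ)) := by
  obtain ⟨τ, ρ, θ, hρ, hs, hμ⟩ := h
  refine ⟨π ++ τ, ρ, θ.comp δ, hρ, ?_, ?_⟩
  · rw [subtermAt_replaceAt_append hb, inst_comp]
    exact subtermAt_inst δ hs
  · simp only [FDist.map, hμ, Multiset.map_map, Function.comp_def]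
    refine Multiset.map_congr rfl fun pr _ => ?_
    rw [replaceAt_inst hs, inst_comp, replaceAt_replaceAt_append hb]

/-! ### Weights of orthogonal occurrences -/

/-- `s` has pairwise orthogonal occurrences of the terms `tσ^m`, with exponents `m` that add up to
at least `x`. -/
def HasWeight (t : L.Term X) (σ : Subst L X) (s : L.Term X) (x : ℕ) : Prop :=
  ∃ (S : Finset (List ℕ)) (m : List ℕ → ℕ),
    (∀ π ∈ S, OccursAt (instPow t σ (m π)) s π) ∧
    (∀ π₁ ∈ S, ∀ π₂ ∈ S, π₁ ≠ π₂ → Orthogonal π₁ π₂) ∧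
    x ≤ ∑ π ∈ S, m π

theorem exists_mem_min_le_of_iSup {A : Set ℕ} (h0 : A.Nonempty) (x : ℕ) :
    ∃ m ∈ A, min (x : ℕ∞) (⨆ k ∈ A, (k : ℕ∞)) ≤ m := by
  by_contra! h
  obtain ⟨m₀, hm₀⟩ := h0
  have hx : 0 < x := by
    have := (h m₀ hm₀).trans_le (min_le_left _ _)
    norm_cast at this
    omega
  have hlt : ∀ k ∈ A, (k : ℕ∞) ≤ ((x - 1 : ℕ) : ℕ∞) := fun k hk => by
    have := (h k hk).trans_le (min_le_left _ _)
    norm_cast at this ⊢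
    omega
  have hne : (⨆ k ∈ A, (k : ℕ∞)) ≠ ⊤ :=
    ne_top_of_le_ne_top (ENat.natCast_ne_top _) (iSup₂_le hlt)
  obtain ⟨n, hn⟩ := ENat.ne_top_iff_exists.1 hne
  have hn0 : ∀ k ∈ A, (k : ℕ∞) ≤ ((n - 1 : ℕ) : ℕ∞) := fun k hk => by
    have := (h k hk).trans_le (min_le_right _ _)
    rw [← hn] at this
    norm_cast at this ⊢
    omega
  have h1 := (iSup₂_le hn0 : (⨆ k ∈ A, (k : ℕ∞)) ≤ _)
  have h2 := (h m₀ hm₀).trans_le (min_le_right _ _)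
  rw [← hn] at h1 h2
  norm_cast at h1 h2
  omega

/-- A natural number below `maxOPO` is a lower bound for the weight of a nonempty set of pairwise
orthogonal occurrences. -/
theorem exists_occurrences_of_le_maxOPO {t s : L.Term X} {σ : Subst L X}
    (ht : ∃ π, OccursAt t s π) {x : ℕ} (hx : (x : ℕ∞) ≤ maxOPO t σ s) :
    ∃ (S : Finset (List ℕ)) (m : List ℕ → ℕ), S.Nonempty ∧
      (∀ π ∈ S, OccursAt (instPow t σ (m π)) s π) ∧
      (∀ π₁ ∈ S, ∀ π₂ ∈ S, π₁ ≠ π₂ → Orthogonal π₁ π₂) ∧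
      x ≤ ∑ π ∈ S, m π := by
  rcases Nat.eq_zero_or_pos x with rfl | hpos
  · obtain ⟨π, hπ⟩ := ht
    exact ⟨{π}, fun _ => 0, by simp, by simpa [instPow] using hπ, by simp, by simp⟩
  obtain ⟨S, ⟨hS, horth⟩, hle⟩ : ∃ S, (S ∈ NO t s ∧
      ∀ π₁ ∈ S, ∀ π₂ ∈ S, π₁ ≠ π₂ → Orthogonal π₁ π₂) ∧
      (x : ℕ∞) ≤ ∑ π ∈ S, multiplicity t σ s π := by
    by_contra! h
    have hle : maxOPO t σ s ≤ ((x - 1 : ℕ) : ℕ∞) := by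
      refine iSup₂_le fun S hS => ?_
      have := h S hS
      obtain ⟨n, hn⟩ := ENat.ne_top_iff_exists.1 this.ne_top
      rw [← hn] at this ⊢
      norm_cast at this ⊢
      omega
    have := hx.trans hle
    norm_cast at this
    omega
  have hmem : ∀ π, ∃ m : ℕ, π ∈ S → OccursAt (instPow t σ m) s π ∧
      min (x : ℕ∞) (multiplicity t σ s π) ≤ m := fun π => by
    by_cases hπ : π ∈ S
    · obtain ⟨m, h1, h2⟩ := exists_mem_min_le_of_iSup
        (A := {m : ℕ | OccursAt (instPow t σ m) s π}) ⟨0, hS.2.1 π hπ⟩ x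
      exact ⟨m, fun _ => ⟨h1, h2⟩⟩
    · exact ⟨0, fun h => absurd h hπ⟩
  choose m hm using hmem
  refine ⟨S, m, ?_, fun π hπ => (hm π hπ).1, horth, ?_⟩
  · rw [Finset.nonempty_iff_ne_empty]
    rintro rfl
    simp at hle
    omega
  · by_cases hbig : ∃ π ∈ S, (x : ℕ∞) ≤ multiplicity t σ s π
    · obtain ⟨π, hπ, h⟩ := hbig
      have := (hm π hπ).2
      rw [min_eq_left h] at this
      exact (Nat.cast_le.1 this).trans (Finset.single_le_sum (fun _ _ => Nat.zero_le _) hπ)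
    · push Not at hbig
      have : (x : ℕ∞) ≤ ((∑ π ∈ S, m π : ℕ) : ℕ∞) := by
        rw [Nat.cast_sum]
        refine hle.trans (Finset.sum_le_sum fun π hπ => ?_)
        have := (hm π hπ).2
        rwa [min_eq_right (hbig π hπ).le] at this
      exact_mod_cast this

/-- One round of the embedded walk. An occurrence of `tσ^(k+1)` in a term of weight `x + 1` is an
instance `(tσ)δ` with `δ = σ^k κ'`. Replacing it by the instance `rδ` of a term `r` all of whose
matchers commute with `σ` turns an occurrence of `tσ^q` in `r` into one of `tσ^(q+k)`, and so costs
at most one unit while it gains the weight `y` of `r`. Nonemptiness of the set of occurrences in `r`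
is what recovers the `k` copies of `σ`, also if `y = 0`. -/
theorem HasWeight.exists_redex {t s : L.Term X} {σ : Subst L X} {x : ℕ}
    (h : HasWeight t σ s (x + 1)) :
    ∃ (π : List ℕ) (δ : Subst L X), subtermAt s π = some (inst (inst t σ) δ) ∧
      ∀ (r : L.Term X) (y : ℕ), (∃ π, OccursAt t r π) → (y : ℕ∞) ≤ maxOPO t σ r →
        (∀ (q : ℕ) (π : List ℕ) (a : L.Term X) (κ : Subst L X),
          subtermAt r π = some a → IsMatcher (instPow t σ q) a κ → σ.Commutes κ) →
        HasWeight t σ (replaceAt s π (inst r δ)) (x + y) := by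
  classical
  obtain ⟨S, m, hocc, horth, hx⟩ := h
  obtain ⟨π, hπ, hm⟩ : ∃ π ∈ S, m π ≠ 0 := by
    by_contra! h0
    rw [Finset.sum_eq_zero h0] at hx
    omega
  obtain ⟨k, hk⟩ := Nat.exists_eq_succ_of_ne_zero hm
  obtain ⟨κ', hκ'⟩ := hocc π hπ
  obtain ⟨δ, hδ⟩ := exists_inst_eq_instPow σ κ' k
  have hsub : subtermAt s π = some (inst (inst t σ) δ) := by
    rw [hκ', hδ, hk, Nat.succ_eq_add_one, Nat.add_comm, instPow_add]
    rfl
  refine ⟨π, δ, hsub, fun r y hr hy hcomm => ?_⟩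
  obtain ⟨R, q, hR, hRocc, hRorth, hyR⟩ := exists_occurrences_of_le_maxOPO hr hy
  have hnp : ∀ τ ∈ S.erase π, Orthogonal π τ := fun τ hτ =>
    horth π hπ τ (Finset.mem_of_mem_erase hτ) (Finset.ne_of_mem_erase hτ).symm
  let m' : List ℕ → ℕ := fun τ => if π <+: τ then q (τ.drop π.length) + k else m τ
  have hm'1 : ∀ τ ∈ S.erase π, m' τ = m τ := fun τ hτ => if_neg (hnp τ hτ).1
  have hm'2 : ∀ τ, m' (π ++ τ) = q τ + k := fun τ => by simp [m']
  have hinj : Function.Injective (π ++ · : List ℕ → List ℕ) := List.append_right_injective π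
  refine ⟨S.erase π ∪ R.image (π ++ ·), m', ?_, ?_, ?_⟩
  · intro τ hτ
    rcases Finset.mem_union.1 hτ with hτ | hτ
    · rw [hm'1 τ hτ, OccursAt, subtermAt_replaceAt_of_orthogonal _ _ (hnp τ hτ)]
      exact hocc τ (Finset.mem_of_mem_erase hτ)
    · obtain ⟨ρ, hρ, rfl⟩ := Finset.mem_image.1 hτ
      obtain ⟨η, hη⟩ := hRocc ρ hρ
      obtain ⟨κ, hκ⟩ := exists_isMatcher (instPow t σ (q ρ)) η
      have hc := hcomm _ _ _ _ hη hκ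
      rw [hm'2]
      refine ⟨κ.comp κ', ?_⟩
      rw [subtermAt_replaceAt_append hsub, subtermAt_inst δ hη, ← hκ.1, hδ, hc.instPow_inst,
        inst_comp, instPow_add]
  · intro τ₁ h₁ τ₂ h₂ hne
    rcases Finset.mem_union.1 h₁ with h₁ | h₁ <;> rcases Finset.mem_union.1 h₂ with h₂ | h₂
    · exact horth _ (Finset.mem_of_mem_erase h₁) _ (Finset.mem_of_mem_erase h₂) hne
    · obtain ⟨ρ, -, rfl⟩ := Finset.mem_image.1 h₂
      have ho := hnp τ₁ h₁
      exact ⟨fun hp => (List.prefix_or_prefix_of_prefix hp (List.prefix_append π ρ)).elim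
          ho.2 ho.1, fun hp => ho.1 ((List.prefix_append π ρ).trans hp)⟩
    · obtain ⟨ρ, -, rfl⟩ := Finset.mem_image.1 h₁
      have ho := hnp τ₂ h₂
      exact ⟨fun hp => ho.1 ((List.prefix_append π ρ).trans hp),
        fun hp => (List.prefix_or_prefix_of_prefix hp (List.prefix_append π ρ)).elim ho.2 ho.1⟩
    · obtain ⟨ρ₁, hρ₁, rfl⟩ := Finset.mem_image.1 h₁
      obtain ⟨ρ₂, hρ₂, rfl⟩ := Finset.mem_image.1 h₂
      have ho := hRorth ρ₁ hρ₁ ρ₂ hρ₂ fun h => hne (by rw [h])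
      simpa only [Orthogonal, List.prefix_append_right_inj] using ho
  · have hdisj : Disjoint (S.erase π) (R.image (π ++ ·)) := by
      rw [Finset.disjoint_left]
      intro τ hτ hτ'
      obtain ⟨ρ, -, rfl⟩ := Finset.mem_image.1 hτ'
      exact (hnp _ hτ).1 (List.prefix_append π ρ)
    have h0 : ∑ τ ∈ S.erase π, m' τ = ∑ τ ∈ S.erase π, m τ := Finset.sum_congr rfl hm'1
    rw [Finset.sum_union hdisj, Finset.sum_image hinj.injOn, h0]
    simp only [hm'2, Finset.sum_add_distrib, Finset.sum_const, smul_eq_mul]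
    have h1 : ∑ τ ∈ S.erase π, m τ + m π = ∑ τ ∈ S, m τ := Finset.sum_erase_add S m hπ
    have h2 : k ≤ R.card * k := Nat.le_mul_of_pos_left k hR.card_pos
    omega

end Terms

/-! ### Rewrite sequence trees, level by level -/

namespace RST

variable {A : Type w} {r : PARS A}

/-- The nodes at depth `n`. -/
def level (T : RST r) : ℕ → Finset (List ℕ)
  | 0 => {[]}
  | n + 1 => (T.level n).biUnion fun v => (Finset.range (T.br v)).image (· :: v)

theorem mem_level {T : RST r} {n : ℕ} {v : List ℕ} :
    v ∈ T.level n ↔ v ∈ T.nodes ∧ v.length = n := by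
  induction v generalizing n with
  | nil => cases n <;> simp [level, nodes, IsNode]
  | cons i v ih =>
    cases n with
    | zero => simp [level]
    | succ n =>
      simp only [level, Finset.mem_biUnion, Finset.mem_image, Finset.mem_range, List.cons.injEq]
      simp only [nodes, Set.mem_ofPred_eq, IsNode, List.length_cons]
      constructor
      · rintro ⟨v', hv, j, hj, rfl, rfl⟩
        obtain ⟨h, h'⟩ := ih.1 hv
        exact ⟨⟨h, hj⟩, by omega⟩
      · rintro ⟨⟨h, hj⟩, h'⟩
        exact ⟨v, ih.2 ⟨h, by omega⟩, i, hj, rfl, rfl⟩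

/-- The leaves at depth less than `n`. -/
def leavesBelow (T : RST r) (n : ℕ) : Finset (List ℕ) :=
  (Finset.range n).biUnion fun k => (T.level k).filter fun v => T.br v = 0

theorem mem_leavesBelow {T : RST r} {n : ℕ} {v : List ℕ} :
    v ∈ T.leavesBelow n ↔ v ∈ T.leaves ∧ v.length < n := by
  simp only [leavesBelow, Finset.mem_biUnion, Finset.mem_range, Finset.mem_filter, mem_level,
    leaves, Set.mem_ofPred_eq]
  constructor
  · rintro ⟨k, hk, ⟨h, rfl⟩, h'⟩
    exact ⟨⟨h, h'⟩, hk⟩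
  · rintro ⟨⟨h, h'⟩, hk⟩
    exact ⟨_, hk, ⟨h, rfl⟩, h'⟩

theorem sum_leavesBelow_succ (T : RST r) (n : ℕ) (a : List ℕ → ℝ) :
    ∑ v ∈ T.leavesBelow (n + 1), a v =
      ∑ v ∈ T.leavesBelow n, a v + ∑ v ∈ T.level n with T.br v = 0, a v := by
  rw [← Finset.sum_union]
  · congr 1
    ext v
    simp only [mem_leavesBelow, Finset.mem_union, Finset.mem_filter, mem_level, leaves,
      Set.mem_ofPred_eq]
    constructor
    · rintro ⟨h, h'⟩
      rcases Nat.lt_succ_iff_lt_or_eq.1 h' with h' | h' <;> simp [h, h']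
    · rintro (⟨h, h'⟩ | ⟨⟨h, h'⟩, h''⟩)
      · exact ⟨h, by omega⟩
      · exact ⟨⟨h, h''⟩, by omega⟩
  · rw [Finset.disjoint_left]
    intro v h h'
    have h1 := (mem_leavesBelow.1 h).2
    have h2 := (mem_level.1 (Finset.mem_filter.1 h').1).2
    omega

theorem sum_level_succ (T : RST r) (n : ℕ) (a : List ℕ → ℝ) :
    ∑ v ∈ T.level (n + 1), a v = ∑ v ∈ T.level n, ∑ i ∈ Finset.range (T.br v), a (i :: v) := by
  rw [level, Finset.sum_biUnion]
  · refine Finset.sum_congr rfl fun v _ => Finset.sum_image ?_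
    intro i _ j _ h
    exact (List.cons.inj h).1
  · intro v _ v' _ hne
    rw [Function.onFun, Finset.disjoint_left]
    intro τ h h'
    obtain ⟨i, -, rfl⟩ := Finset.mem_image.1 h
    obtain ⟨j, -, h⟩ := Finset.mem_image.1 h'
    exact hne (List.cons.inj h).2.symm

theorem prob_pos {T : RST r} {v : List ℕ} (h : v ∈ T.nodes) : 0 < T.prob v :=
  (T.prob_mem v h).1

theorem sum_prob_div {T : RST r} {v : List ℕ} (h : v ∈ T.nodes) (hbr : 0 < T.br v) :
    ∑ i ∈ Finset.range (T.br v), T.prob (i :: v) / T.prob v = 1 := by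
  obtain ⟨μ, -, hμ⟩ := T.step v h hbr
  have := μ.sum_eq_one
  rw [hμ, Multiset.map_map] at this
  exact this

theorem sum_prob {T : RST r} {v : List ℕ} (h : v ∈ T.nodes) (hbr : 0 < T.br v) :
    ∑ i ∈ Finset.range (T.br v), T.prob (i :: v) = T.prob v := by
  have := sum_prob_div h hbr
  rwa [← Finset.sum_div, div_eq_one_iff_eq (prob_pos h).ne'] at this

/-- A quantity that, at every inner node, exceeds the sum over the successors by at most `b`, is at
the root bounded by the sum over the leaves above a given level, the sum over that level, and the
excesses in between. -/
theorem le_sum_leavesBelow_add {T : RST r} {a b : List ℕ → ℝ}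
    (h : ∀ v ∈ T.nodes, 0 < T.br v → a v ≤ b v + ∑ i ∈ Finset.range (T.br v), a (i :: v))
    (n : ℕ) :
    a [] ≤ ∑ v ∈ T.leavesBelow n, a v +
      ∑ k ∈ Finset.range n, ∑ v ∈ T.level k with T.br v ≠ 0, b v + ∑ v ∈ T.level n, a v := by
  induction n with
  | zero => simp [leavesBelow, level]
  | succ n ih =>
    rw [sum_leavesBelow_succ, Finset.sum_range_succ, sum_level_succ]
    rw [← Finset.sum_filter_add_sum_filter_not (T.level n) (fun v => T.br v = 0) a] at ih
    rw [← Finset.sum_filter_add_sum_filter_not (T.level n) (fun v => T.br v = 0)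
      fun v => ∑ i ∈ Finset.range (T.br v), a (i :: v)]
    have h0 : ∑ v ∈ T.level n with T.br v = 0, ∑ i ∈ Finset.range (T.br v), a (i :: v) = 0 :=
      Finset.sum_eq_zero fun v hv => by simp [(Finset.mem_filter.1 hv).2]
    have h1 : ∑ v ∈ T.level n with ¬T.br v = 0, a v ≤
        ∑ v ∈ T.level n with ¬T.br v = 0, b v +
        ∑ v ∈ T.level n with ¬T.br v = 0, ∑ i ∈ Finset.range (T.br v), a (i :: v) := by
      rw [← Finset.sum_add_distrib]
      refine Finset.sum_le_sum fun v hv => ?_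
      obtain ⟨hv, hv'⟩ := Finset.mem_filter.1 hv
      exact h v (mem_level.1 hv).1 (Nat.pos_of_ne_zero hv')
    simp only [ne_eq] at ih ⊢
    linarith

theorem sum_leavesBelow_add_sum_level (T : RST r) (n : ℕ) :
    ∑ v ∈ T.leavesBelow n, T.prob v + ∑ v ∈ T.level n, T.prob v = 1 := by
  have h1 := le_sum_leavesBelow_add (T := T) (a := T.prob) (b := 0)
    (fun v hv hbr => by simp [sum_prob hv hbr]) n
  have h2 := le_sum_leavesBelow_add (T := T) (a := fun v => -T.prob v) (b := 0)
    (fun v hv hbr => by simp [sum_prob hv hbr]) n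
  simp only [Pi.zero_apply, Finset.sum_const_zero, add_zero, Finset.sum_neg_distrib,
    T.prob_root] at h1 h2
  linarith

theorem sum_leavesBelow_le_tsum (T : RST r) (a : List ℕ → ℝ≥0∞) (n : ℕ) :
    ∑ v ∈ T.leavesBelow n, a v ≤ ∑' v : T.leaves, a v := by
  classical
  have := ENNReal.sum_le_tsum (f := fun v : T.leaves => a v)
    ((T.leavesBelow n).subtype (· ∈ T.leaves))
  rwa [Finset.sum_subtype_of_mem (p := (· ∈ T.leaves)) a
    fun v hv => (mem_leavesBelow.1 hv).1] at this

theorem exists_lt_sum_leavesBelow (T : RST r) (a : List ℕ → ℝ≥0∞) {c : ℝ≥0∞}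
    (h : c < ∑' v : T.leaves, a v) : ∃ n, c < ∑ v ∈ T.leavesBelow n, a v := by
  classical
  rw [ENNReal.tsum_eq_iSup_sum] at h
  obtain ⟨F, hF⟩ := lt_iSup_iff.1 h
  refine ⟨F.sup (fun v => v.1.length) + 1, hF.trans_le ?_⟩
  change ∑ v ∈ F, a (Function.Embedding.subtype _ v) ≤ _
  rw [← Finset.sum_map F (Function.Embedding.subtype _) a]
  refine Finset.sum_le_sum_of_subset fun v hv => ?_
  obtain ⟨v', hv', rfl⟩ := Finset.mem_map.1 hv
  exact mem_leavesBelow.2 ⟨v'.2, Nat.lt_succ_of_le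
    (Finset.le_sup (f := fun v : T.leaves => v.1.length) hv')⟩

theorem termProb_le_one (T : RST r) : T.termProb ≤ 1 := by
  by_contra! h
  obtain ⟨n, hn⟩ := T.exists_lt_sum_leavesBelow (fun v => ENNReal.ofReal (T.prob v)) h
  rw [← ENNReal.ofReal_sum_of_nonneg
    (fun v hv => (prob_pos (mem_leavesBelow.1 hv).1.1).le)] at hn
  have h1 := T.sum_leavesBelow_add_sum_level n
  have h2 : 0 ≤ ∑ v ∈ T.level n, T.prob v :=
    Finset.sum_nonneg fun v hv => (prob_pos (mem_level.1 hv).1).le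
  have := ENNReal.one_lt_ofReal.1 hn
  linarith

theorem eq_one_of_edl_lt_top {T : RST r} (h : T.edl < ∞) : T.termProb = 1 := by
  refine T.termProb_le_one.antisymm ?_
  by_contra! h1
  simp [edl, h1] at h

/-- If the tree terminates almost surely, the probability to reach level `n` becomes small. -/
theorem exists_sum_level_lt {T : RST r} (h : T.termProb = 1) {ε : ℝ} (hε : 0 < ε) :
    ∃ n, ∑ v ∈ T.level n, T.prob v < ε := by
  have h1 : ENNReal.ofReal (1 - ε) < T.termProb := by
    rw [h]
    exact ENNReal.ofReal_lt_one.2 (by linarith)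
  obtain ⟨n, hn⟩ := T.exists_lt_sum_leavesBelow (fun v => ENNReal.ofReal (T.prob v)) h1
  rw [← ENNReal.ofReal_sum_of_nonneg
    (fun v hv => (prob_pos (mem_leavesBelow.1 hv).1.1).le)] at hn
  have := lt_of_not_ge fun hle => hn.not_ge (ENNReal.ofReal_le_ofReal hle)
  have h2 := T.sum_leavesBelow_add_sum_level n
  exact ⟨n, by linarith⟩

theorem sum_level_anti (T : RST r) {m n : ℕ} (h : m ≤ n) :
    ∑ v ∈ T.level n, T.prob v ≤ ∑ v ∈ T.level m, T.prob v := by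
  have hsub : T.leavesBelow m ⊆ T.leavesBelow n := fun v hv =>
    mem_leavesBelow.2 ⟨(mem_leavesBelow.1 hv).1, (mem_leavesBelow.1 hv).2.trans_le h⟩
  have h1 := Finset.sum_le_sum_of_subset_of_nonneg (f := T.prob) hsub
    fun v hv _ => (prob_pos (mem_leavesBelow.1 hv).1.1).le
  have h2 := T.sum_leavesBelow_add_sum_level m
  have h3 := T.sum_leavesBelow_add_sum_level n
  linarith

theorem sum_depth_le_edl {T : RST r} (h : T.edl < ∞) (n : ℕ) :
    ∑ v ∈ T.leavesBelow n, (v.length : ℝ) * T.prob v ≤ T.edl.toReal := by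
  have hedl : T.edl = ∑' v : T.leaves, (T.depth v : ℝ≥0∞) * ENNReal.ofReal (T.prob v) := by
    simp [edl, eq_one_of_edl_lt_top h]
  rw [← ENNReal.ofReal_le_iff_le_toReal h.ne, hedl]
  refine le_trans (le_of_eq ?_) (T.sum_leavesBelow_le_tsum
    (fun v => (T.depth v : ℝ≥0∞) * ENNReal.ofReal (T.prob v)) n)
  rw [ENNReal.ofReal_sum_of_nonneg fun v hv =>
    mul_nonneg (Nat.cast_nonneg _) (prob_pos (mem_leavesBelow.1 hv).1.1).le]
  refine Finset.sum_congr rfl fun v _ => ?_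
  rw [ENNReal.ofReal_mul (Nat.cast_nonneg _), ENNReal.ofReal_natCast]
  rfl

/-- The expected number of steps among the first `n` is at most the expected derivation length. It
is the expectation of `min (depth v) n` over the leaves `v`, up to the mass that is still
unresolved at a late level. -/
theorem sum_inner_le_edl {T : RST r} (h : T.edl < ∞) (n : ℕ) :
    ∑ k ∈ Finset.range n, ∑ v ∈ T.level k with T.br v ≠ 0, T.prob v ≤ T.edl.toReal := by
  refine le_of_forall_pos_le_add fun ε hε => ?_
  obtain ⟨M', hM'⟩ := exists_sum_level_lt (eq_one_of_edl_lt_top h) (ε := ε / (n + 1))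
    (by positivity)
  obtain ⟨M, hnM, hM⟩ : ∃ M, n ≤ M ∧ ∑ v ∈ T.level M, T.prob v < ε / (n + 1) :=
    ⟨max n M', le_max_left _ _, (T.sum_level_anti (le_max_right _ _)).trans_lt hM'⟩
  have h1 := le_sum_leavesBelow_add (T := T)
    (a := fun v => (min v.length n : ℕ) * T.prob v)
    (b := fun v => if v.length < n then -T.prob v else 0) (fun v hv hbr => ?_) M
  · have h2 : ∑ v ∈ T.leavesBelow M, ((min v.length n : ℕ) : ℝ) * T.prob v ≤ T.edl.toReal :=
      (Finset.sum_le_sum fun v hv => mul_le_mul_of_nonneg_right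
        (Nat.cast_le.2 (min_le_left _ _)) (prob_pos (mem_leavesBelow.1 hv).1.1).le).trans
        (sum_depth_le_edl h M)
    have h3 : ∑ v ∈ T.level M, ((min v.length n : ℕ) : ℝ) * T.prob v ≤ ε := by
      calc _ ≤ ∑ v ∈ T.level M, (n : ℝ) * T.prob v :=
            Finset.sum_le_sum fun v hv => mul_le_mul_of_nonneg_right
              (Nat.cast_le.2 (min_le_right _ _)) (prob_pos (mem_level.1 hv).1).le
        _ = n * ∑ v ∈ T.level M, T.prob v := by rw [Finset.mul_sum]
        _ ≤ n * (ε / (n + 1)) := by gcongr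
        _ ≤ ε := by
          rw [mul_div_assoc', div_le_iff₀ (by positivity)]
          nlinarith
    have h4 : ∑ k ∈ Finset.range M, ∑ v ∈ T.level k with T.br v ≠ 0,
        (if v.length < n then -T.prob v else 0) =
        -∑ k ∈ Finset.range n, ∑ v ∈ T.level k with T.br v ≠ 0, T.prob v := by
      rw [← Finset.sum_neg_distrib]
      symm
      calc _ = ∑ k ∈ Finset.range n, ∑ v ∈ T.level k with T.br v ≠ 0,
            (if v.length < n then -T.prob v else 0) := by
            refine Finset.sum_congr rfl fun k hk => ?_
            rw [← Finset.sum_neg_distrib]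
            refine Finset.sum_congr rfl fun v hv => (if_pos ?_).symm
            rw [(mem_level.1 (Finset.mem_filter.1 hv).1).2]
            exact Finset.mem_range.1 hk
        _ = _ := by
            refine Finset.sum_subset (Finset.range_subset_range.2 hnM) fun k _ hk => ?_
            refine Finset.sum_eq_zero fun v hv => if_neg ?_
            rw [(mem_level.1 (Finset.mem_filter.1 hv).1).2]
            exact fun h => hk (Finset.mem_range.2 h)
    simp only [List.length_nil, Nat.zero_min, Nat.cast_zero, zero_mul] at h1
    linarith
  · simp only [List.length_cons, ← Finset.mul_sum, sum_prob hv hbr]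
    split_ifs with hlt
    · rw [min_eq_left hlt.le, min_eq_left (by omega : v.length + 1 ≤ n)]
      push_cast
      linarith
    · rw [min_eq_right (by omega), min_eq_right (by omega : n ≤ v.length + 1)]
      linarith

/-- A function bounded by `1` that is not positive at the leaves and decreases by at most `d` per
step on average is, at the root, at most `d` times the expected number of steps among the first `n`,
plus the probability to reach level `n`. -/
theorem le_mul_add_sum_level {T : RST r} {f : List ℕ → ℝ} {d : ℝ}
    (hle : ∀ v ∈ T.nodes, f v ≤ 1) (hleaf : ∀ v ∈ T.leaves, f v ≤ 0)
    (h : ∀ v ∈ T.nodes, 0 < T.br v →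
      f v ≤ d + ∑ i ∈ Finset.range (T.br v), T.prob (i :: v) / T.prob v * f (i :: v)) (n : ℕ) :
    f [] ≤ d * ∑ k ∈ Finset.range n, ∑ v ∈ T.level k with T.br v ≠ 0, T.prob v +
      ∑ v ∈ T.level n, T.prob v := by
  have h1 := le_sum_leavesBelow_add (T := T) (a := fun v => T.prob v * f v)
    (b := fun v => d * T.prob v) (fun v hv hbr => ?_) n
  · have h2 : ∑ v ∈ T.leavesBelow n, T.prob v * f v ≤ 0 :=
      Finset.sum_nonpos fun v hv => mul_nonpos_of_nonneg_of_nonpos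
        (prob_pos (mem_leavesBelow.1 hv).1.1).le (hleaf v (mem_leavesBelow.1 hv).1)
    have h3 : ∑ v ∈ T.level n, T.prob v * f v ≤ ∑ v ∈ T.level n, T.prob v :=
      Finset.sum_le_sum fun v hv =>
        mul_le_of_le_one_right (prob_pos (mem_level.1 hv).1).le (hle v (mem_level.1 hv).1)
    simp only [T.prob_root, one_mul, ← Finset.mul_sum] at h1
    linarith
  · have hp := prob_pos hv
    have := mul_le_mul_of_nonneg_left (h v hv hbr) hp.le
    rw [mul_add, Finset.mul_sum] at this
    refine this.trans (le_of_eq ?_)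
    rw [mul_comm d]
    congr 1
    refine Finset.sum_congr rfl fun i _ => ?_
    field_simp

/-- If the tree terminates almost surely, a bounded submartingale that is not positive at the
leaves is not positive at the root. -/
theorem nonpos_of_termProb_eq_one {T : RST r} (hone : T.termProb = 1) {f : List ℕ → ℝ}
    (hle : ∀ v ∈ T.nodes, f v ≤ 1) (hleaf : ∀ v ∈ T.leaves, f v ≤ 0)
    (h : ∀ v ∈ T.nodes, 0 < T.br v →
      f v ≤ 0 + ∑ i ∈ Finset.range (T.br v), T.prob (i :: v) / T.prob v * f (i :: v)) :
    f [] ≤ 0 := by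
  refine le_of_forall_pos_le_add fun ε hε => ?_
  obtain ⟨n, hn⟩ := exists_sum_level_lt hone hε
  have := le_mul_add_sum_level hle hleaf h n
  linarith

/-- If the expected derivation length is finite, then a function bounded by `1` that is not positive
at the leaves and decreases by at most `d` per step on average is at most `d * edl` at the root. -/
theorem le_mul_edl {T : RST r} (hedl : T.edl < ∞) {f : List ℕ → ℝ} {d : ℝ} (hd : 0 ≤ d)
    (hle : ∀ v ∈ T.nodes, f v ≤ 1) (hleaf : ∀ v ∈ T.leaves, f v ≤ 0)
    (h : ∀ v ∈ T.nodes, 0 < T.br v →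
      f v ≤ d + ∑ i ∈ Finset.range (T.br v), T.prob (i :: v) / T.prob v * f (i :: v)) :
    f [] ≤ d * T.edl.toReal := by
  refine le_of_forall_pos_le_add fun ε hε => ?_
  obtain ⟨n, hn⟩ := exists_sum_level_lt (eq_one_of_edl_lt_top hedl) hε
  have := le_mul_add_sum_level hle hleaf h n
  have := mul_le_mul_of_nonneg_left (sum_inner_le_edl hedl n) hd
  linarith

/-! ### Unfolding a transition system into a rewrite sequence tree -/

/-- A transition system whose steps project to steps of `r` unfolds to an RST. The relation `R`
records whatever else is known about the steps of the system. -/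
theorem exists_unfold {St : Type*} (obj : St → A) (halted : St → Prop)
    (R : St → ℕ → (ℕ → ℝ) → (ℕ → St) → Prop)
    (h : ∀ q, ¬ halted q → ∃ (n : ℕ) (pr : ℕ → ℝ) (next : ℕ → St) (μ : FDist A),
      r (obj q) μ ∧ μ.pairs = (Multiset.range n).map (fun i => (pr i, obj (next i))) ∧
      R q n pr next) (q₀ : St) :
    ∃ (T : RST r) (state : List ℕ → St), state [] = q₀ ∧
      (∀ v ∈ T.leaves, halted (state v)) ∧
      ∀ v ∈ T.nodes, 0 < T.br v →
        R (state v) (T.br v) (fun i => T.prob (i :: v) / T.prob v) fun i => state (i :: v) := by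
  classical
  choose n pr next μ hr hμ hR using h
  have hn : ∀ q hq, 0 < n q hq := fun q hq => by
    rw [Nat.pos_iff_ne_zero]
    intro h0
    have h1 := (μ q hq).sum_eq_one
    rw [hμ, h0] at h1
    simp at h1
  have hpr : ∀ q hq, ∀ i < n q hq, 0 < pr q hq i ∧ pr q hq i ≤ 1 := fun q hq i hi =>
    (μ q hq).prob_mem (pr q hq i, obj (next q hq i))
      (by rw [hμ]; exact Multiset.mem_map.2 ⟨i, by simpa using hi, rfl⟩)
  let state : List ℕ → St := fun v =>
    v.rec q₀ fun i _ q => if hq : halted q then q else next q hq i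
  let br : List ℕ → ℕ := fun v => if hq : halted (state v) then 0 else n _ hq
  let prob : List ℕ → ℝ := fun v =>
    v.rec 1 fun i v p => if hq : halted (state v) then p else p * pr _ hq i
  have hstate : ∀ i v (hq : ¬ halted (state v)), state (i :: v) = next _ hq i := fun i v hq =>
    dif_neg hq
  have hprob : ∀ i v (hq : ¬ halted (state v)), prob (i :: v) = prob v * pr _ hq i := fun i v hq =>
    dif_neg hq
  have hbr : ∀ v (hq : ¬ halted (state v)), br v = n _ hq := fun v hq => dif_neg hq
  have hbr0 : ∀ v, 0 < br v → ¬ halted (state v) := fun v hv hq => by simp [br, hq] at hv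
  have hmem : ∀ v, IsNode br v → 0 < prob v ∧ prob v ≤ 1 := by
    intro v
    induction v with
    | nil => exact fun _ => ⟨one_pos, le_rfl⟩
    | cons i v ih =>
      rintro ⟨hv, hi⟩
      have hq := hbr0 v (by omega)
      rw [hbr v hq] at hi
      have h1 := hpr _ hq i hi
      have h2 := ih hv
      rw [hprob i v hq]
      exact ⟨mul_pos h2.1 h1.1, mul_le_one₀ h2.2 h1.1.le h1.2⟩
  have hratio : ∀ i v (_ : IsNode br v) (hq : ¬ halted (state v)),
      prob (i :: v) / prob v = pr _ hq i := fun i v hv hq => by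
    rw [hprob i v hq, mul_div_cancel_left₀ _ (hmem v hv).1.ne']
  refine ⟨⟨br, prob, fun v => obj (state v), rfl, hmem, fun v hv hpos => ?_⟩, state, rfl, ?_, ?_⟩
  · have hq := hbr0 v hpos
    refine ⟨μ _ hq, hr _ hq, ?_⟩
    rw [hμ, hbr v hq]
    refine Multiset.map_congr rfl fun i _ => ?_
    rw [hratio i v hv hq, hstate i v hq]
  · rintro v ⟨-, hv⟩
    by_contra hq
    have : br v = 0 := hv
    rw [hbr v hq] at this
    exact (hn _ hq).ne' this
  · intro v hv hpos
    have hq := hbr0 v hpos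
    have := hR _ hq
    simp only [hstate _ v hq, hratio _ v hv hq]
    rwa [hbr v hq]

end RST

/-! ### Truncated conditional expectations -/

namespace RST

variable {A : Type w} {r : PARS A}

/-- The conditional expectation of `a` at the leaf that is reached from the given node, where the
paths that reach no leaf within fewer than `n` steps contribute `0`. -/
noncomputable def truncExp (T : RST r) (a : List ℕ → ℝ) : ℕ → List ℕ → ℝ
  | 0, _ => 0
  | n + 1, v =>
    if T.br v = 0 then a v
    else ∑ i ∈ Finset.range (T.br v), T.prob (i :: v) / T.prob v * T.truncExp a n (i :: v)

theorem cons_mem_nodes {T : RST r} {v : List ℕ} (hv : v ∈ T.nodes) {i : ℕ} (hi : i < T.br v) :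
    i :: v ∈ T.nodes := ⟨hv, hi⟩

theorem truncExp_mem_Icc {T : RST r} {a : List ℕ → ℝ} (ha : ∀ v, a v ∈ Set.Icc (0 : ℝ) 1) (n : ℕ)
    {v : List ℕ} (hv : v ∈ T.nodes) : T.truncExp a n v ∈ Set.Icc (0 : ℝ) 1 := by
  induction n generalizing v with
  | zero => simp [truncExp]
  | succ n ih =>
    rw [truncExp]
    split_ifs with hbr
    · exact ha v
    have hi : ∀ i ∈ Finset.range (T.br v), 0 ≤ T.prob (i :: v) / T.prob v ∧
        T.truncExp a n (i :: v) ∈ Set.Icc (0 : ℝ) 1 := fun i hi => by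
      have hm := cons_mem_nodes hv (Finset.mem_range.1 hi)
      exact ⟨(div_pos (prob_pos hm) (prob_pos hv)).le, ih hm⟩
    refine ⟨Finset.sum_nonneg fun i h => mul_nonneg (hi i h).1 (hi i h).2.1, ?_⟩
    rw [← sum_prob_div hv (Nat.pos_of_ne_zero hbr)]
    exact Finset.sum_le_sum fun i h => mul_le_of_le_one_right (hi i h).1 (hi i h).2.2

theorem truncExp_le_of_leaf {T : RST r} {a : List ℕ → ℝ} {v : List ℕ} (ha : 0 ≤ a v)
    (hbr : T.br v = 0) (n : ℕ) : T.truncExp a n v ≤ a v := by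
  cases n <;> simp [truncExp, hbr, ha]

theorem truncExp_of_inner {T : RST r} (a : List ℕ → ℝ) {v : List ℕ} (hbr : 0 < T.br v) (n : ℕ) :
    T.truncExp a n v = ∑ i ∈ Finset.range (T.br v),
      T.prob (i :: v) / T.prob v * T.truncExp a (n - 1) (i :: v) := by
  cases n with
  | zero => simp [truncExp]
  | succ n => simp [truncExp, hbr.ne']

/-- At the root, the truncated expectation accounts for all leaves above the truncation level. -/
theorem sum_leavesBelow_le_truncExp (T : RST r) (a : List ℕ → ℝ) (n : ℕ) :
    ∑ v ∈ T.leavesBelow n, T.prob v * a v ≤ T.truncExp a n [] := by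
  have h := le_sum_leavesBelow_add (T := T)
    (a := fun v => -(T.prob v * T.truncExp a (n - v.length) v)) (b := 0) (fun v hv hbr => ?_) n
  · have h1 : ∑ v ∈ T.leavesBelow n, -(T.prob v * T.truncExp a (n - v.length) v) =
        -∑ v ∈ T.leavesBelow n, T.prob v * a v := by
      rw [← Finset.sum_neg_distrib]
      refine Finset.sum_congr rfl fun v hv => ?_
      obtain ⟨hv, hlt⟩ := mem_leavesBelow.1 hv
      obtain ⟨k, hk⟩ := Nat.exists_eq_succ_of_ne_zero (by omega : n - v.length ≠ 0)
      rw [hk, truncExp, if_pos hv.2]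
    have h2 : ∑ v ∈ T.level n, -(T.prob v * T.truncExp a (n - v.length) v) = 0 :=
      Finset.sum_eq_zero fun v hv => by simp [(mem_level.1 hv).2, truncExp]
    simp only [List.length_nil, Nat.sub_zero, T.prob_root, one_mul, Pi.zero_apply,
      Finset.sum_const_zero] at h
    linarith
  · rw [truncExp_of_inner a hbr, Finset.mul_sum, Pi.zero_apply, zero_add, Finset.sum_neg_distrib,
      neg_le_neg_iff]
    refine Finset.sum_le_sum fun i hi => le_of_eq ?_
    have := (prob_pos hv).ne'
    rw [List.length_cons, ← Nat.sub_sub]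
    field_simp

theorem br_root_pos {T : RST r} (h : 0 < T.height) : 0 < T.br [] := by
  by_contra h0
  refine h.ne' (nonpos_iff_eq_zero.1 (iSup₂_le fun v hv => ?_))
  have hnil : ∀ v, IsNode T.br v → v = [] := by
    intro v
    induction v with
    | nil => exact fun _ => rfl
    | cons i v ih =>
      rintro ⟨hv, hi⟩
      rw [ih hv] at hi
      omega
  rw [hnil v hv]
  simp [depth]

end RST

/-! ### The embedded walk -/

section Walk

variable {L : FirstOrder.Language.{u, v}} {X : Type w} {P : PTRS L X}

/-- The invariant of the embedded walk. The term `s` arises from a term `b` by replacing a redex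
`(tσ)δ` at some position by the instance by `δ` of the label of the node `u` of `T`. Moving on to
any leaf `v` of `T` instead of `u` yields a term of weight `x + W v`. -/
def WalkInv (T : RST P.step) (t : L.Term X) (σ : Subst L X) (W : List ℕ → ℕ)
    (s : L.Term X) (x : ℕ) (u : List ℕ) : Prop :=
  u ∈ T.nodes ∧ ∃ (b : L.Term X) (π : List ℕ) (δ : Subst L X),
    subtermAt b π = some (inst (inst t σ) δ) ∧ s = replaceAt b π (inst (T.obj u) δ) ∧
    ∀ v ∈ T.leaves, HasWeight t σ (replaceAt b π (inst (T.obj v) δ)) (x + W v)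

variable {T : RST P.step} {t : L.Term X} {σ : Subst L X} {W : List ℕ → ℕ}

theorem HasWeight.walkInv (htree : IsPatternTree T t σ)
    (hW : ∀ v ∈ T.leaves, (W v : ℕ∞) ≤ maxOPO t σ (T.obj v)) {s : L.Term X} {x : ℕ}
    (h : HasWeight t σ s (x + 1)) : WalkInv T t σ W s x [] := by
  obtain ⟨π, δ, hsub, hrep⟩ := h.exists_redex
  refine ⟨trivial, s, π, δ, hsub, ?_, fun v hv => hrep _ _ (htree.occurs v hv) (hW v hv)
    (htree.commutes v hv)⟩
  have : T.obj [] = inst t σ := htree.root_eq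
  rw [this, replaceAt_self hsub]

theorem hasWeight_root (t : L.Term X) (σ : Subst L X) : HasWeight t σ (inst t σ) (0 + 1) :=
  ⟨{[]}, fun _ => 1, by simpa [OccursAt, subtermAt] using ⟨Subst.id, (inst_id _).symm⟩,
    by simp, by simp⟩

theorem WalkInv.hasWeight {s : L.Term X} {x : ℕ} {u : List ℕ} (h : WalkInv T t σ W s x u)
    (hbr : T.br u = 0) : HasWeight t σ s (x + W u) := by
  obtain ⟨hu, b, π, δ, -, rfl, hleaf⟩ := h
  exact hleaf u ⟨hu, hbr⟩

theorem WalkInv.step_inner {s : L.Term X} {x : ℕ} {u : List ℕ} (h : WalkInv T t σ W s x u)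
    (hbr : 0 < T.br u) :
    ∃ (next : ℕ → L.Term X) (μ : FDist (L.Term X)), P.step s μ ∧
      μ.pairs = (Multiset.range (T.br u)).map (fun i => (T.prob (i :: u) / T.prob u, next i)) ∧
      ∀ i < T.br u, WalkInv T t σ W (next i) x (i :: u) := by
  obtain ⟨hu, b, π, δ, hsub, rfl, hleaf⟩ := h
  obtain ⟨μ, hstep, hμ⟩ := T.step u hu hbr
  refine ⟨fun i => replaceAt b π (inst (T.obj (i :: u)) δ), _,
    PTRS.step_replaceAt_inst hstep hsub δ, ?_, fun i hi => ⟨RST.cons_mem_nodes hu hi, b, π, δ,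
      hsub, rfl, hleaf⟩⟩
  simp only [FDist.map, hμ, Multiset.map_map, Function.comp_def]

/-- The Lyapunov function of the walk: `1 - c^x` for the walk on `ℕ`, interpolated at the nodes `u`
of `T` by the conditional expectation, truncated at level `N`. -/
noncomputable def potential (T : RST P.step) (W : List ℕ → ℕ) (c : ℝ) (N x : ℕ) (u : List ℕ) : ℝ :=
  1 - c ^ x * (1 - T.truncExp (fun v => 1 - c ^ W v) (N - u.length) u)

variable {c : ℝ}

theorem one_sub_pow_mem_Icc (hc : c ∈ Set.Ioo (0 : ℝ) 1) (W : List ℕ → ℕ) (v : List ℕ) :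
    1 - c ^ W v ∈ Set.Icc (0 : ℝ) 1 := by
  have h1 := pow_nonneg hc.1.le (W v)
  have h2 := pow_le_one₀ (n := W v) hc.1.le hc.2.le
  constructor <;> linarith

theorem potential_le_one (hc : c ∈ Set.Ioo (0 : ℝ) 1) (N x : ℕ) {u : List ℕ} (hu : u ∈ T.nodes) :
    potential T W c N x u ≤ 1 := by
  have h := (RST.truncExp_mem_Icc (one_sub_pow_mem_Icc hc W) (N - u.length) hu).2
  have := mul_nonneg (pow_nonneg hc.1.le x) (sub_nonneg.2 h)
  rw [potential]
  linarith

theorem potential_of_inner (N x : ℕ) {u : List ℕ} (hu : u ∈ T.nodes) (hbr : 0 < T.br u) :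
    potential T W c N x u = ∑ i ∈ Finset.range (T.br u),
      T.prob (i :: u) / T.prob u * potential T W c N x (i :: u) := by
  have h1 := RST.sum_prob_div hu hbr
  simp only [potential, mul_sub, Finset.sum_sub_distrib, mul_one, h1, List.length_cons,
    mul_left_comm _ (c ^ x)]
  simp only [← Finset.mul_sum, ← Finset.sum_mul, h1, RST.truncExp_of_inner _ hbr, Nat.sub_sub]
  simp only [mul_comm _ (c ^ x), mul_one]

theorem potential_of_leaf_le (hc : c ∈ Set.Ioo (0 : ℝ) 1) (N x : ℕ) {u : List ℕ}
    (hbr : T.br u = 0) : potential T W c N x u ≤ 1 - c ^ (x + W u) := by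
  have h := RST.truncExp_le_of_leaf (a := fun v => 1 - c ^ W v)
    (one_sub_pow_mem_Icc hc W u).1 hbr (N - u.length)
  have := mul_le_mul_of_nonneg_left h (pow_nonneg hc.1.le x)
  rw [potential, pow_add]
  linarith

/-- The loss of potential when a new round of the walk starts. -/
theorem le_add_potential_root (hc : c ∈ Set.Ioo (0 : ℝ) 1) {d : ℝ} (hd : 0 ≤ d) {N : ℕ}
    (h : 1 - c ≤ d + T.truncExp (fun v => 1 - c ^ W v) N []) (x : ℕ) :
    1 - c ^ (x + 1) ≤ d + potential T W c N x [] := by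
  have h1 := pow_nonneg hc.1.le x
  have h2 := pow_le_one₀ (n := x) hc.1.le hc.2.le
  rw [potential, pow_succ]
  simp only [List.length_nil, Nat.sub_zero]
  nlinarith [mul_le_mul_of_nonneg_left h h1, mul_le_of_le_one_left hd h2]

/-- The embedded walk is a single rewrite sequence tree that carries the potentials for all bases
`c` and truncation levels `N` at once. At the root, the potential is the truncated expectation of
`1 - c^W`; it is not positive at the leaves, and on average it decreases in each step by at most
the loss at the start of a round. -/
theorem exists_walk_tree (htree : IsPatternTree T t σ) (hheight : 0 < T.height)
    (hW : ∀ v ∈ T.leaves, (W v : ℕ∞) ≤ maxOPO t σ (T.obj v)) :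
    ∃ T' : RST P.step, ∀ (c : ℝ) (N : ℕ) (d : ℝ), c ∈ Set.Ioo (0 : ℝ) 1 → 0 ≤ d →
      1 - c ≤ d + T.truncExp (fun v => 1 - c ^ W v) N [] →
      ∃ f : List ℕ → ℝ, f [] = T.truncExp (fun v => 1 - c ^ W v) N [] ∧
        (∀ v ∈ T'.nodes, f v ≤ 1) ∧ (∀ v ∈ T'.leaves, f v ≤ 0) ∧
        ∀ v ∈ T'.nodes, 0 < T'.br v → f v ≤ d + ∑ i ∈ Finset.range (T'.br v),
          T'.prob (i :: v) / T'.prob v * f (i :: v) := by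
  -- A state is a term, the value of the walk at the start of the round without the unit for the
  -- chosen redex, and the current node of `T`. At a leaf of `T` the next round starts, and its
  -- first step is taken at once: the root of `T` is not a leaf.
  let St := {q : L.Term X × ℕ × List ℕ // WalkInv T t σ W q.1 q.2.1 q.2.2}
  let halted : St → Prop := fun q => T.br q.1.2.2 = 0 ∧ q.1.2.1 + W q.1.2.2 = 0
  let F : ℝ → ℕ → St → ℝ := fun c N q => potential T W c N q.1.2.1 q.1.2.2
  let R : St → ℕ → (ℕ → ℝ) → (ℕ → St) → Prop := fun q n pr next =>
    ∀ (c : ℝ) (N : ℕ) (d : ℝ), c ∈ Set.Ioo (0 : ℝ) 1 → 0 ≤ d →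
      1 - c ≤ d + T.truncExp (fun v => 1 - c ^ W v) N [] →
      F c N q ≤ d + ∑ i ∈ Finset.range n, pr i * F c N (next i)
  have hinner : ∀ (s : L.Term X) (x : ℕ) (u : List ℕ), WalkInv T t σ W s x u → 0 < T.br u →
      ∃ (n : ℕ) (pr : ℕ → ℝ) (next : ℕ → St) (μ : FDist (L.Term X)), P.step s μ ∧
        μ.pairs = (Multiset.range n).map (fun i => (pr i, (next i).1.1)) ∧
        ∀ c N, potential T W c N x u = ∑ i ∈ Finset.range n, pr i * F c N (next i) := by
    intro s x u h hbr
    obtain ⟨next, μ, hstep, hμ, hnext⟩ := h.step_inner hbr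
    classical
    let next' : ℕ → St := fun i =>
      if hi : i < T.br u then ⟨(next i, x, i :: u), hnext i hi⟩ else ⟨(s, x, u), h⟩
    have hn : ∀ i < T.br u, (next' i).1 = (next i, x, i :: u) := fun i hi => by
      simp [next', hi]
    refine ⟨T.br u, fun i => T.prob (i :: u) / T.prob u, next', μ, hstep, ?_, fun c N => ?_⟩
    · rw [hμ]
      refine Multiset.map_congr rfl fun i hi => ?_
      rw [hn i (Multiset.mem_range.1 hi)]
    · rw [potential_of_inner N x h.1 hbr]
      refine Finset.sum_congr rfl fun i hi => ?_
      simp only [F, hn i (Finset.mem_range.1 hi)]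
  have hnext : ∀ q : St, ¬ halted q → ∃ (n : ℕ) (pr : ℕ → ℝ) (next : ℕ → St)
      (μ : FDist (L.Term X)), P.step q.1.1 μ ∧
      μ.pairs = (Multiset.range n).map (fun i => (pr i, (next i).1.1)) ∧ R q n pr next := by
    intro q hq
    obtain ⟨⟨s, x, u⟩, h⟩ := q
    rcases Nat.eq_zero_or_pos (T.br u) with hbr | hbr
    · obtain ⟨y, hy⟩ := Nat.exists_eq_succ_of_ne_zero fun h0 => hq ⟨hbr, h0⟩
      have hweight := h.hasWeight hbr
      rw [show x + W u = y + 1 from hy] at hweight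
      obtain ⟨n, pr, next, μ, hstep, hμ, hF⟩ :=
        hinner s y [] (hweight.walkInv htree hW) (RST.br_root_pos hheight)
      refine ⟨n, pr, next, μ, hstep, hμ, fun c N d hc hd hcd => ?_⟩
      rw [← hF]
      refine (potential_of_leaf_le hc N x hbr).trans ?_
      rw [show x + W u = y + 1 from hy]
      exact le_add_potential_root hc hd hcd y
    · obtain ⟨n, pr, next, μ, hstep, hμ, hF⟩ := hinner s x u h hbr
      refine ⟨n, pr, next, μ, hstep, hμ, fun c N d hc hd _ => ?_⟩
      rw [← hF]
      exact le_add_of_nonneg_left hd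
  obtain ⟨T', state, h0, hleaf, hnode⟩ := RST.exists_unfold (r := P.step)
    (fun q : St => q.1.1) halted R hnext
    ⟨(inst t σ, 0, []), (hasWeight_root t σ).walkInv htree hW⟩
  refine ⟨T', fun c N d hc hd hcd => ⟨fun v => F c N (state v), ?_, ?_, ?_, ?_⟩⟩
  · simp [h0, F, potential]
  · exact fun v _ => potential_le_one hc N _ (state v).2.1
  · intro v hv
    obtain ⟨h1, h2⟩ := hleaf v hv
    have := potential_of_leaf_le (W := W) hc N (state v).1.2.1 h1
    rw [h2, pow_zero, sub_self] at this
    exact this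
  · exact fun v hv hbr => hnode v hv hbr c N d hc hd hcd

end Walk

/-! ### Choice of the base and conclusion -/

/-- For `c` close to `1`, the expectation of `1 - c^W` is almost `(1 - c) * E[W]` or more, because
`1 - c^n = (1 - c) * (1 + c + ⋯ + c^(n-1)) ≥ (1 - c) * n * c^n`. -/
theorem exists_base {ι : Type*} (B : Finset ι) (p : ι → ℝ) (hp : ∀ i ∈ B, 0 ≤ p i) (W : ι → ℕ)
    {θ : ℝ} (h : θ < ∑ i ∈ B, p i * W i) :
    ∃ c ∈ Set.Ioo (0 : ℝ) 1, (1 - c) * θ ≤ ∑ i ∈ B, p i * (1 - c ^ W i) := by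
  have hcont : Filter.Tendsto (fun c : ℝ => ∑ i ∈ B, p i * (W i * c ^ W i))
      (nhdsWithin 1 (Set.Iio 1)) (nhds (∑ i ∈ B, p i * (W i * (1 : ℝ) ^ W i))) :=
    (Continuous.tendsto (by fun_prop) 1).mono_left nhdsWithin_le_nhds
  simp only [one_pow, mul_one] at hcont
  obtain ⟨c, hc, hIoo⟩ := ((hcont.eventually (lt_mem_nhds h)).and
    (Ioo_mem_nhdsLT (zero_lt_one' ℝ))).exists
  refine ⟨c, hIoo, (mul_le_mul_of_nonneg_left hc.le (sub_nonneg.2 hIoo.2.le)).trans ?_⟩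
  rw [Finset.mul_sum]
  refine Finset.sum_le_sum fun i hi => ?_
  rw [mul_left_comm]
  refine mul_le_mul_of_nonneg_left ?_ (hp i hi)
  rw [← mul_neg_geom_sum c (W i)]
  refine mul_le_mul_of_nonneg_left ?_ (sub_nonneg.2 hIoo.2.le)
  calc (W i : ℝ) * c ^ W i = ∑ j ∈ Finset.range (W i), c ^ W i := by simp
    _ ≤ _ := Finset.sum_le_sum fun j hj =>
      pow_le_pow_of_le_one hIoo.1.le hIoo.2.le (Finset.mem_range.1 hj).le

theorem RST.exists_base {A : Type w} {r : PARS A} (T : RST r) (W : List ℕ → ℕ) {θ : ℝ}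
    (hθ : 0 ≤ θ)
    (h : ENNReal.ofReal θ < ∑' v : T.leaves, ENNReal.ofReal (T.prob v) * (W v : ℝ≥0∞)) :
    ∃ c ∈ Set.Ioo (0 : ℝ) 1, ∃ N, (1 - c) * θ ≤ T.truncExp (fun v => 1 - c ^ W v) N [] := by
  obtain ⟨N, hN⟩ := T.exists_lt_sum_leavesBelow
    (fun v => ENNReal.ofReal (T.prob v) * (W v : ℝ≥0∞)) h
  have hp : ∀ v ∈ T.leavesBelow N, 0 ≤ T.prob v := fun v hv =>
    (prob_pos (mem_leavesBelow.1 hv).1.1).le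
  have hsum : ∑ v ∈ T.leavesBelow N, ENNReal.ofReal (T.prob v) * (W v : ℝ≥0∞) =
      ENNReal.ofReal (∑ v ∈ T.leavesBelow N, T.prob v * W v) := by
    rw [ENNReal.ofReal_sum_of_nonneg fun v hv => mul_nonneg (hp v hv) (Nat.cast_nonneg _)]
    refine Finset.sum_congr rfl fun v hv => ?_
    rw [ENNReal.ofReal_mul (hp v hv), ENNReal.ofReal_natCast]
  rw [hsum, ENNReal.ofReal_lt_ofReal_iff_of_nonneg hθ] at hN
  obtain ⟨c, hc, hle⟩ := ProbRewriting.exists_base _ _ hp W hN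
  exact ⟨c, hc, N, hle.trans (T.sum_leavesBelow_le_truncExp _ N)⟩

/-- Extended weights can be lowered to natural numbers so that the expectation stays the same
or is larger than `1`: a leaf of infinite weight can be given a weight whose contribution alone
exceeds `1`. -/
theorem RST.exists_nat_weight {A : Type w} {r : PARS A} (T : RST r) (M : List ℕ → ℕ∞) :
    ∃ W : List ℕ → ℕ, (∀ v, (W v : ℕ∞) ≤ M v) ∧
      (∑' v : T.leaves, ENNReal.ofReal (T.prob v) * (M v : ℝ≥0∞) =
        ∑' v : T.leaves, ENNReal.ofReal (T.prob v) * (W v : ℝ≥0∞) ∨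
      1 < ∑' v : T.leaves, ENNReal.ofReal (T.prob v) * (W v : ℝ≥0∞)) := by
  classical
  refine ⟨fun v => if M v = ⊤ then ⌈2 / T.prob v⌉₊ else (M v).toNat, fun v => ?_, ?_⟩
  · dsimp only
    split_ifs with h
    · rw [h]; exact le_top
    · rw [ENat.natCast_toNat h]
  by_cases h : ∃ v ∈ T.leaves, M v = ⊤
  · right
    obtain ⟨v, hv, hM⟩ := h
    refine lt_of_lt_of_le ?_ (ENNReal.le_tsum ⟨v, hv⟩)
    have hp := prob_pos hv.1
    simp only [if_pos hM]
    rw [← ENNReal.ofReal_natCast, ← ENNReal.ofReal_mul hp.le, ENNReal.one_lt_ofReal]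
    have := mul_le_mul_of_nonneg_left (Nat.le_ceil (2 / T.prob v)) hp.le
    rw [mul_div_cancel₀ _ hp.ne'] at this
    linarith
  · left
    push Not at h
    refine tsum_congr fun v => ?_
    have hM := h v v.2
    obtain ⟨n, hn⟩ := ENat.ne_top_iff_exists.1 hM
    simp only [if_neg hM]
    rw [← hn]
    simp

end ProbRewriting

theorem mainTheorem5 {L : FirstOrder.Language.{u, v}} [Finite (Σ n, L.Functions n)]
    {X : Type w} [Infinite X]
    (P : ProbRewriting.PTRS L X) (t : L.Term X) (σ : ProbRewriting.Subst L X)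
    (hpattern : ProbRewriting.IsPatternTerm t σ)
    (T : ProbRewriting.RST P.step)
    (htree : ProbRewriting.IsPatternTree T t σ)
    (hheight : 0 < T.height) :
    (1 < ∑' v : T.leaves,
        ENNReal.ofReal (T.prob v) * (ProbRewriting.maxOPO t σ (T.obj v) : ℝ≥0∞) →
      ¬ ProbRewriting.IsAST P.step) ∧
    (1 ≤ ∑' v : T.leaves,
        ENNReal.ofReal (T.prob v) * (ProbRewriting.maxOPO t σ (T.obj v) : ℝ≥0∞) →
      ¬ ProbRewriting.IsPAST P.step) := by
  obtain ⟨W, hW, hsum⟩ := T.exists_nat_weight fun v => ProbRewriting.maxOPO t σ (T.obj v)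
  obtain ⟨T', hT'⟩ := ProbRewriting.exists_walk_tree htree hheight (W := W) fun v _ => hW v
  constructor
  · intro h hAST
    have h1 : 1 < ∑' v : T.leaves, ENNReal.ofReal (T.prob v) * (W v : ℝ≥0∞) :=
      hsum.elim (fun he => he ▸ h) id
    obtain ⟨c, hc, N, hle⟩ := T.exists_base W zero_le_one (by simpa using h1)
    obtain ⟨f, hf, hf1, hf0, hstep⟩ := hT' c N 0 hc le_rfl (by linarith)
    have := ProbRewriting.RST.nonpos_of_termProb_eq_one (hAST T') hf1 hf0 hstep
    have := hc.2
    linarith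
  · intro h hPAST
    have h1 : 1 ≤ ∑' v : T.leaves, ENNReal.ofReal (T.prob v) * (W v : ℝ≥0∞) :=
      hsum.elim (fun he => he ▸ h) le_of_lt
    have hE : 0 ≤ T'.edl.toReal := ENNReal.toReal_nonneg
    -- With expected weight above `1 - ε`, the loss per step is `(1 - c) * ε`, while the potential
    -- at the root is at least `(1 - c) * (1 - ε)`; this `ε` makes `ε * edl < 1 - ε`.
    set ε : ℝ := 1 / (T'.edl.toReal + 2) with hε
    have hε0 : 0 < ε := by positivity
    have hε1 : ε * (T'.edl.toReal + 2) = 1 := by rw [hε]; field_simp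
    have hε2 : ε * T'.edl.toReal < 1 - ε := by linarith
    have hε3 := mul_nonneg hε0.le hE
    obtain ⟨c, hc, N, hle⟩ := T.exists_base W (θ := 1 - ε) (by linarith)
      ((ENNReal.ofReal_lt_one.2 (by linarith)).trans_le h1)
    have hc1 : 0 < 1 - c := sub_pos.2 hc.2
    have hd : 0 ≤ (1 - c) * ε := mul_nonneg hc1.le hε0.le
    obtain ⟨f, hf, hf1, hf0, hstep⟩ := hT' c N ((1 - c) * ε) hc hd (by linarith)
    have h2 := ProbRewriting.RST.le_mul_edl (hPAST T') hd hf1 hf0 hstep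
    have h3 := mul_lt_mul_of_pos_left hε2 hc1
    linarith
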